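/- Let $H$ be a separable infinite-dimensional complex Hilbert space, let $B(H)$ be the algebra of bounded linear operators on $H$, and let $X$ be a locally compact Hausdorff space. Denote by $C_0(X)$ and $C_0(X,B(H))$ the $C^*$-algebras of continuous functions on $X$ vanishing at infinity, with values in $\mathbb{C}$ and in $B(H)$ (with its norm topology), respectively. For a Banach algebra $A$ let $\operatorname{Aut}(A)$ be the group of all automorphisms of $A$, i.e. of all multiplicative linear bijections $A\to A$. Call $\operatorname{Aut}(A)$ algebraically reflexive if every local automorphism of $A$ is an automorphism, i.e. if every bounded linear map $T:A\to A$ such that for each $a\in A$ there is $\tau_a\in\operatorname{Aut}(A)$ with $T(a)=\tau_a(a)$ belongs to $\operatorname{Aut}(A)$. If $\operatorname{Aut}(C_0(X))$ is algebraically reflexive, then so is $\operatorname{Aut}(C_0(X,B(H)))$. -/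

import Mathlib

open scoped ZeroAtInfty

/-- The algebra automorphisms of a complex algebra `A`: the multiplicative linear bijections
of `A` onto itself (neither compatibility with an involution nor continuity is required). -/
def algAut (A : Type*) [NonUnitalNormedRing A] [NormedSpace ℂ A] : Set (A →ₗ[ℂ] A) :=
  {φ | Function.Bijective φ ∧ ∀ a b : A, φ (a * b) = φ a * φ b}

/-- The algebraic reflexive closure of a set `E` of linear transformations of `V`: the bounded
linear maps on `V` which agree, at each vector, with some member of `E` depending on it. -/
def refAl {V : Type*} [NormedAddCommGroup V] [NormedSpace ℂ V] (E : Set (V →ₗ[ℂ] V)) :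
    Set (V →L[ℂ] V) :=
  {T | ∀ x : V, ∃ S ∈ E, T x = S x}

/-- `E` is algebraically reflexive: the bounded linear maps that belong to `E` locally are
precisely the bounded linear maps that belong to `E`. -/
def IsAlgReflexive {V : Type*} [NormedAddCommGroup V] [NormedSpace ℂ V]
    (E : Set (V →ₗ[ℂ] V)) : Prop :=
  refAl E = {T : V →L[ℂ] V | (T : V →ₗ[ℂ] V) ∈ E}

/-! Automorphisms preserve the center, which consists of the scalar functions. A local automorphism
T therefore induces a local automorphism of C₀(X). By hypothesis this is an automorphism, hence
composition with a bijection φ of X (`exists_equiv_of_algAut`).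

T lives over φ. If F(φ x) = 0, adding 2‖F(·)‖·1 to F leaves T F x unchanged, but locality then puts
the spectrum of T F x in Re ≥ 0; using F and -F together forces T F x = 0 (`local_apply_eq_zero`).
So T F x = σ_x(F(φ x)), with σ_x bounded, unital and locally a nonzero multiple of an automorphism
of B(H).

Such a σ is conjugation by an invertible U (`IsScaledLocalAut.exists_conj`). It preserves rank at
most one, so it acts on x ⊗ f as Ux ⊗ Vf or in transposed form. Injective weighted shifts, norm
limits of finite rank operators, exclude the transposed and degenerate forms. Preservation of
invertibility gives V f = f ∘ U⁻¹ and carries the formula from rank one to all operators.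

Finally, ‖A‖ ≤ ‖T‖ ‖σ_x A‖ uniformly in x, so pointwise preimages are continuous and vanish at
infinity, and T is onto. -/

/-! ### Linear and bilinear maps with elementary tensors as values -/

/-- A bilinear map behaving like the formation of elementary tensors. -/
structure IsTensorLike {Y G Z : Type*} [AddCommGroup Y] [Module ℂ Y] [AddCommGroup G] [Module ℂ G]
    [AddCommGroup Z] [Module ℂ Z] (m : Y →ₗ[ℂ] G →ₗ[ℂ] Z) : Prop where
  eq_zero : ∀ y g, m y g = 0 → y = 0 ∨ g = 0
  left_of_eq : ∀ y y' g g', m y g = m y' g' → m y g ≠ 0 → ∃ c : ℂ, y' = c • y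
  right_of_eq : ∀ y y' g g', m y g = m y' g' → m y g ≠ 0 → ∃ c : ℂ, g' = c • g
  of_add : ∀ y y' y'' g g' g'', m y g + m y' g' = m y'' g'' → y ≠ 0 → g ≠ 0 →
    (∃ c : ℂ, y' = c • y) ∨ ∃ c : ℂ, g' = c • g

namespace IsTensorLike

variable {Y G Z E F : Type*} [AddCommGroup Y] [Module ℂ Y] [AddCommGroup G] [Module ℂ G]
  [AddCommGroup Z] [Module ℂ Z] [AddCommGroup E] [Module ℂ E] [AddCommGroup F] [Module ℂ F]
  {m : Y →ₗ[ℂ] G →ₗ[ℂ] Z}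

theorem flip (hm : IsTensorLike m) : IsTensorLike m.flip where
  eq_zero y g h := (hm.eq_zero g y h).symm
  left_of_eq y y' g g' h h' := hm.right_of_eq g g' y y' h h'
  right_of_eq y y' g g' h h' := hm.left_of_eq g g' y y' h h'
  of_add y y' y'' g g' g'' h hy hg := (hm.of_add g g' g'' y y' y'' h hg hy).symm

theorem left_inj (hm : IsTensorLike m) {y y' : Y} {g : G} (hg : g ≠ 0) (h : m y g = m y' g) :
    y = y' := by
  have : m (y - y') g = 0 := by simp [h]
  exact sub_eq_zero.1 ((hm.eq_zero _ _ this).resolve_right hg)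

theorem right_inj (hm : IsTensorLike m) {y : Y} {g g' : G} (hy : y ≠ 0) (h : m y g = m y g') :
    g = g' := hm.flip.left_inj (y := g) (y' := g') hy h

/-- A linear map into elementary tensors has all its values in a common row or column. -/
theorem linear_pure (hm : IsTensorLike m) (Q : E →ₗ[ℂ] Z) (hQ : ∀ x, ∃ y g, Q x = m y g) :
    (∃ g, ∀ x, ∃ y, Q x = m y g) ∨ ∃ y, ∀ x, ∃ g, Q x = m y g := by
  by_cases h0 : ∀ x, Q x = 0
  · exact Or.inl ⟨0, fun x => ⟨0, by simp [h0]⟩⟩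
  push Not at h0
  obtain ⟨x₀, hx₀⟩ := h0
  obtain ⟨y₀, g₀, h₀⟩ := hQ x₀
  have hy₀ : y₀ ≠ 0 := by rintro rfl; simp [h₀] at hx₀
  have hg₀ : g₀ ≠ 0 := by rintro rfl; simp [h₀] at hx₀
  -- Purity of `Q (x₀ + x)` makes `Q x` share a factor with `Q x₀`. Thus `E` is a union of two
  -- subspaces, hence equal to one of them.
  have key : ∀ x, (∃ y, Q x = m y g₀) ∨ ∃ g, Q x = m y₀ g := by
    intro x
    obtain ⟨y, g, h⟩ := hQ x
    obtain ⟨y'', g'', h''⟩ := hQ (x₀ + x)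
    rw [map_add, h₀, h] at h''
    rcases hm.of_add _ _ _ _ _ _ h'' hy₀ hg₀ with ⟨c, rfl⟩ | ⟨c, rfl⟩
    · exact Or.inr ⟨c • g, by simp [h]⟩
    · exact Or.inl ⟨c • y, by simp [h]⟩
  by_contra hcon
  push Not at hcon
  obtain ⟨⟨a, ha⟩, ⟨b, hb⟩⟩ := And.intro (hcon.1 g₀) (hcon.2 y₀)
  obtain ⟨ga, hga⟩ := (key a).resolve_left (by push Not; exact ha)
  obtain ⟨yb, hyb⟩ := (key b).resolve_right (by push Not; exact hb)
  rcases key (a + b) with ⟨y, h⟩ | ⟨g, h⟩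
  · exact ha (y - yb) (by rw [map_sub, LinearMap.sub_apply, ← h, ← hyb]; simp)
  · exact hb (g - ga) (by rw [map_sub, ← h, ← hga]; simp)

/-- A bilinear map into elementary tensors one of whose partial maps runs in a column. -/
theorem bilinear_of_column (hm : IsTensorLike m) (R : E →ₗ[ℂ] F →ₗ[ℂ] Z)
    (hR : ∀ x f, ∃ y g, R x f = m y g) (hR0 : ∀ x f, R x f = 0 → x = 0 ∨ f = 0)
    [Nontrivial E] (hF : ∀ f : F, ∃ f', ∀ c : ℂ, f' ≠ c • f)
    (hN : ∀ g, ∃ x f, ∀ y, R x f ≠ m y g)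
    {f₀ : F} (hf₀ : f₀ ≠ 0) {g₀ : G} (hcol : ∀ x, ∃ y, R x f₀ = m y g₀) :
    ∃ (U : E →ₗ[ℂ] Y) (V : F →ₗ[ℂ] G), ∀ x f, R x f = m (U x) (V f) := by
  obtain ⟨e, he⟩ := exists_ne (0 : E)
  have hR' : ∀ {x f}, x ≠ 0 → f ≠ 0 → R x f ≠ 0 := fun hx hf h => by
    rcases hR0 _ _ h with h | h
    exacts [hx h, hf h]
  choose u hu using hcol
  have hg₀ : g₀ ≠ 0 := by
    rintro rfl
    exact hR' he hf₀ (by simp [hu])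
  let U : E →ₗ[ℂ] Y :=
    { toFun := u
      map_add' := fun a b => hm.left_inj hg₀ (by
        rw [← hu, map_add, map_add, LinearMap.add_apply, LinearMap.add_apply, hu, hu])
      map_smul' := fun c a => hm.left_inj hg₀ (by
        rw [← hu, map_smul, map_smul, LinearMap.smul_apply, LinearMap.smul_apply, hu]
        rfl) }
  have hU : ∀ x, R x f₀ = m (U x) g₀ := hu
  have hU0 : ∀ {x}, x ≠ 0 → U x ≠ 0 := fun {x} hx h => hR' hx hf₀ (by simp [hU, h])
  have dich : ∀ x, (∀ f, ∃ y, R x f = m y g₀) ∨ ∀ f, ∃ g, R x f = m (U x) g := by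
    intro x
    by_cases hx : x = 0
    · exact Or.inl fun f => ⟨0, by simp [hx]⟩
    have hne := hR' hx hf₀
    rcases hm.linear_pure (R x) (hR x) with ⟨g, hg⟩ | ⟨y, hy⟩
    · left
      obtain ⟨y, hy⟩ := hg f₀
      obtain ⟨c, rfl⟩ := hm.right_of_eq _ _ _ _ ((hU x).symm.trans hy) (hU x ▸ hne)
      intro f
      obtain ⟨y', hy'⟩ := hg f
      exact ⟨c • y', by simp [hy']⟩
    · right
      obtain ⟨g, hg⟩ := hy f₀
      obtain ⟨c, rfl⟩ := hm.left_of_eq _ _ _ _ ((hU x).symm.trans hg) (hU x ▸ hne)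
      intro f
      obtain ⟨g', hg'⟩ := hy f
      exact ⟨c • g', by simp [hg']⟩
  have row : ∀ x f, ∃ g, R x f = m (U x) g := by
    obtain ⟨x₁, f₁, h₁⟩ := hN g₀
    have hx₁ : x₁ ≠ 0 := by
      rintro rfl
      exact h₁ 0 (by simp)
    have hW := (dich x₁).resolve_left fun h => by
      obtain ⟨y, hy⟩ := h f₁
      exact h₁ y hy
    intro y
    by_cases hy0 : y = 0
    · exact fun f => ⟨0, by simp [hy0]⟩
    refine (dich y).resolve_left fun hy => ?_
    -- Were `R y` to run in the column of `g₀`, purity of `R (x₁ + y) f` would push its values onto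
    -- the line of `R x₁ f₀`, contradicting injectivity since `F` is not a line.
    have off : ∀ f, (∀ y', R x₁ f ≠ m y' g₀) → ∃ c : ℂ, R y f = c • R x₁ f₀ := by
      intro f hf
      obtain ⟨q, hq⟩ := hW f
      obtain ⟨p, hp⟩ := hy f
      obtain ⟨y'', g'', h''⟩ := hR (x₁ + y) f
      rw [map_add, LinearMap.add_apply, hq, hp] at h''
      have hq0 : q ≠ 0 := by
        rintro rfl
        exact hf 0 (by simp [hq])
      rcases hm.of_add _ _ _ _ _ _ h'' (hU0 hx₁) hq0 with ⟨c, rfl⟩ | ⟨c, hc⟩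
      · exact ⟨c, by rw [hp, hU]; simp⟩
      · have hc0 : c ≠ 0 := by
          rintro rfl
          exact hg₀ (by simpa using hc)
        exact absurd (by rw [hq, hc]; simp [hc0]) (hf (c⁻¹ • U x₁))
    have all : ∀ f, ∃ c : ℂ, R y f = c • R x₁ f₀ := by
      intro f
      by_cases hf : ∀ y', R x₁ f ≠ m y' g₀
      · exact off f hf
      push Not at hf
      obtain ⟨y', hy'⟩ := hf
      obtain ⟨c₁, hc₁⟩ := off f₁ h₁
      obtain ⟨c₂, hc₂⟩ := off (f₁ + f) fun z hz => h₁ (z - y') (by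
        rw [map_sub, LinearMap.sub_apply, ← hz, ← hy']; simp)
      refine ⟨c₂ - c₁, ?_⟩
      rw [sub_smul, ← hc₁, ← hc₂]
      simp
    obtain ⟨f', hf'⟩ := hF f₀
    obtain ⟨a, ha⟩ := all f₀
    obtain ⟨b, hb⟩ := all f'
    have ha0 : a ≠ 0 := by
      rintro rfl
      exact hR' hy0 hf₀ (by simpa using ha)
    have hz : R y (f' - (b / a) • f₀) = 0 := by
      rw [map_sub, map_smul, ha, hb, smul_smul, div_mul_cancel₀ _ ha0, sub_self]
    exact hf' _ (sub_eq_zero.1 ((hR0 _ _ hz).resolve_left hy0))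
  choose v hv using row e
  let V : F →ₗ[ℂ] G :=
    { toFun := v
      map_add' := fun a b => hm.right_inj (hU0 he) (by rw [← hv, map_add, map_add, hv, hv])
      map_smul' := fun c a => hm.right_inj (hU0 he) (by
        rw [← hv, map_smul, map_smul, hv]; rfl) }
  have hV : ∀ f, R e f = m (U e) (V f) := hv
  refine ⟨U, V, fun x f => ?_⟩
  by_cases hx : ∃ c : ℂ, x = c • e
  · obtain ⟨c, rfl⟩ := hx
    simp [hV]
  have hx0 : x ≠ 0 := by
    rintro rfl
    exact hx ⟨0, by simp⟩
  obtain ⟨g, hg⟩ := row x f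
  obtain ⟨g'', h''⟩ := row (x + e) f
  -- As `U x` and `U e` are independent, both sides must vanish.
  have heq : m (U x) (g - g'') = m (U e) (g'' - V f) := by
    rw [map_add, LinearMap.add_apply, hg, hV, map_add U, map_add m, LinearMap.add_apply] at h''
    rw [map_sub, map_sub, sub_eq_sub_iff_add_eq_add, h'', add_comm]
  have hz : m (U x) (g - g'') = 0 := by
    by_contra hne
    obtain ⟨c, hc⟩ := hm.left_of_eq _ _ _ _ heq.symm (heq ▸ hne)
    rw [← map_smul] at hc
    refine hx ⟨c, ?_⟩
    by_contra hne'
    exact hU0 (sub_ne_zero.2 hne') (by rw [map_sub, hc, sub_self])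
  have h1 := sub_eq_zero.1 ((hm.eq_zero _ _ hz).resolve_left (hU0 hx0))
  have h2 := sub_eq_zero.1 ((hm.eq_zero _ _ (heq.symm.trans hz)).resolve_left (hU0 he))
  rw [hg, h1, h2]

/-- A nondegenerate bilinear map into elementary tensors is elementary, up to exchanging the
factors. -/
theorem bilinear_pure (hm : IsTensorLike m) (R : E →ₗ[ℂ] F →ₗ[ℂ] Z)
    (hR : ∀ x f, ∃ y g, R x f = m y g) (hR0 : ∀ x f, R x f = 0 → x = 0 ∨ f = 0)
    [Nontrivial E] [Nontrivial F] (hF : ∀ f : F, ∃ f', ∀ c : ℂ, f' ≠ c • f)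
    (hN : ∀ g, ∃ x f, ∀ y, R x f ≠ m y g) (hN' : ∀ y, ∃ x f, ∀ g, R x f ≠ m y g) :
    (∃ (U : E →ₗ[ℂ] Y) (V : F →ₗ[ℂ] G), ∀ x f, R x f = m (U x) (V f)) ∨
      ∃ (U : E →ₗ[ℂ] G) (V : F →ₗ[ℂ] Y), ∀ x f, R x f = m (V f) (U x) := by
  obtain ⟨f₀, hf₀⟩ := exists_ne (0 : F)
  rcases hm.linear_pure (R.flip f₀) (fun x => hR x f₀) with ⟨g, hg⟩ | ⟨y, hy⟩
  · exact Or.inl (hm.bilinear_of_column R hR hR0 hF hN hf₀ hg)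
  · exact Or.inr (hm.flip.bilinear_of_column R
      (fun x f => by obtain ⟨a, b, h⟩ := hR x f; exact ⟨b, a, h⟩) hR0 hF hN' hf₀ hy)

end IsTensorLike

/-! ### Hilbert bases and compact weighted shifts -/

section Hilbert

variable {H : Type*} [NormedAddCommGroup H] [InnerProductSpace ℂ H]

/-- A separable Hilbert space of infinite dimension has a Hilbert basis indexed by `ℕ`. -/
theorem exists_hilbertBasis_nat [CompleteSpace H] [TopologicalSpace.SeparableSpace H]
    (hH : ¬ FiniteDimensional ℂ H) : Nonempty (HilbertBasis ℕ ℂ H) := by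
  obtain ⟨w, b, -⟩ := exists_hilbertBasis ℂ H
  have hinf : Infinite w := by
    by_contra hfin
    rw [not_infinite_iff_finite] at hfin
    have := Fintype.ofFinite w
    exact hH b.toOrthonormalBasis.toBasis.finiteDimensional_of_finite
  have hcount : Countable w := by
    refine Pairwise.countable_of_isOpen_disjoint (α := H)
      (s := fun i => Metric.ball (b i) (1 / 2)) (fun i j hij => ?_) (fun _ => Metric.isOpen_ball)
      fun i => ⟨b i, by simp⟩
    refine Metric.ball_disjoint_ball ?_
    have h : ‖b i - b j‖ ^ 2 = 2 := by
      rw [@norm_sub_sq ℂ, b.orthonormal.1 i, b.orthonormal.1 j, b.orthonormal.2 hij]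
      norm_num
    rw [dist_eq_norm]
    nlinarith [norm_nonneg (b i - b j)]
  obtain ⟨φ⟩ := nonempty_equiv_of_countable (α := ℕ) (β := w)
  refine ⟨HilbertBasis.mk (v := fun n => b (φ n)) (b.orthonormal.comp φ φ.injective) ?_⟩
  have : Set.range (fun n => b (φ n)) = Set.range b := φ.surjective.range_comp b
  rw [this, b.dense_span]

theorem HilbertBasis.eq_zero_of_inner {ι : Type*} (b : HilbertBasis ι ℂ H) {z : H}
    (h : ∀ i, inner ℂ (b i) z = 0) : z = 0 := by
  have := b.hasSum_repr z
  simp only [b.repr_apply_apply, h, zero_smul] at this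
  exact this.unique hasSum_zero

/-- The compact weighted shift `∑ 2⁻ⁿ e_{n+j} ⊗ e_n`. -/
noncomputable def weightedShift (b : HilbertBasis ℕ ℂ H) (j : ℕ) : H →L[ℂ] H :=
  ∑' n : ℕ, ((1 / 2 : ℂ) ^ n • innerSL ℂ (b n)).smulRight (b (n + j))

/-- The geometric weights give convergence in operator norm, so bounded maps on operators may be
applied term by term. -/
theorem hasSum_weightedShift [CompleteSpace H] (b : HilbertBasis ℕ ℂ H) (j : ℕ) :
    HasSum (fun n : ℕ => ((1 / 2 : ℂ) ^ n • innerSL ℂ (b n)).smulRight (b (n + j)))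
      (weightedShift b j) := by
  refine Summable.hasSum (Summable.of_norm_bounded (g := fun n => (1 / 2 : ℝ) ^ n)
    summable_geometric_two fun n => ?_)
  rw [ContinuousLinearMap.norm_smulRight_apply, norm_smul, innerSL_apply_norm, b.orthonormal.1,
    b.orthonormal.1]
  simp

theorem inner_weightedShift [CompleteSpace H] (b : HilbertBasis ℕ ℂ H) (j n : ℕ) (z : H) :
    inner ℂ (b (n + j)) (weightedShift b j z) = (1 / 2 : ℂ) ^ n * inner ℂ (b n) z := by
  have h := (hasSum_weightedShift b j).mapL ((innerSL ℂ (b (n + j))).comp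
    (ContinuousLinearMap.apply ℂ H z))
  have h' := hasSum_single (f := fun k => ((innerSL ℂ (b (n + j))).comp
    (ContinuousLinearMap.apply ℂ H z)) (((1 / 2 : ℂ) ^ k • innerSL ℂ (b k)).smulRight (b (k + j))))
    n fun k hk => by
      have := b.orthonormal.2 (i := n + j) (j := k + j) (by omega)
      simp [this]
  have := h.unique h'
  simpa [b.orthonormal.1] using this

theorem weightedShift_injective [CompleteSpace H] (b : HilbertBasis ℕ ℂ H) (j : ℕ) {z : H}
    (hz : weightedShift b j z = 0) : z = 0 := by
  refine b.eq_zero_of_inner fun n => ?_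
  have := inner_weightedShift b j n z
  rw [hz, inner_zero_right] at this
  simpa using this.symm

theorem weightedShift_zero_apply [CompleteSpace H] (b : HilbertBasis ℕ ℂ H) (n : ℕ) :
    weightedShift b 0 (b n) = (1 / 2 : ℂ) ^ n • b n := by
  refine sub_eq_zero.1 (b.eq_zero_of_inner fun k => ?_)
  have := inner_weightedShift b 0 k (b n)
  rw [add_zero] at this
  rw [inner_sub_right, this, inner_smul_right]
  by_cases h : k = n
  · subst h; simp
  · simp [b.orthonormal.2 h]

theorem isLeftRegular_weightedShift [CompleteSpace H] (b : HilbertBasis ℕ ℂ H) (j : ℕ)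
    (B : H →L[ℂ] H) (h : weightedShift b j * B = 0) : B = 0 := by
  ext z
  exact weightedShift_injective b j (DFunLike.congr_fun h z)

/-- The unshifted operator has dense range, since it multiplies each basis vector by a nonzero
scalar. For `j > 0` the range is orthogonal to `b 0`. -/
theorem isRightRegular_weightedShift [CompleteSpace H] (b : HilbertBasis ℕ ℂ H)
    (B : H →L[ℂ] H) (h : B * weightedShift b 0 = 0) : B = 0 := by
  have hB : ∀ n, B (b n) = 0 := fun n => by
    have := DFunLike.congr_fun h (b n)
    simpa [weightedShift_zero_apply] using this
  ext z
  have := (b.hasSum_repr z).mapL B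
  simp only [map_smul, hB, smul_zero] at this
  exact this.unique hasSum_zero

end Hilbert

/-! ### Rank one operators -/

section RankOne

variable {H : Type*} [NormedAddCommGroup H] [NormedSpace ℂ H]

/-- The bilinear map `(x, f) ↦ x ⊗ f`. -/
noncomputable def rankOneBilin (H : Type*) [NormedAddCommGroup H] [NormedSpace ℂ H] :
    H →ₗ[ℂ] (H →L[ℂ] ℂ) →ₗ[ℂ] (H →L[ℂ] H) :=
  LinearMap.mk₂ ℂ (fun x f => f.smulRight x) (fun _ _ _ => by ext; simp)
    (fun c x f => by ext z; exact smul_comm _ _ _) (fun _ _ _ => by ext; simp [add_smul])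
    (fun _ _ _ => by ext; exact mul_smul _ _ _)

@[simp]
theorem rankOneBilin_apply (x : H) (f : H →L[ℂ] ℂ) : rankOneBilin H x f = f.smulRight x := rfl

theorem exists_functional_eq_one {x : H} (hx : x ≠ 0) : ∃ f : H →L[ℂ] ℂ, f x = 1 := by
  obtain ⟨g, -, hg⟩ := exists_dual_vector ℂ x (norm_ne_zero_iff.2 hx)
  refine ⟨(‖x‖ : ℂ)⁻¹ • g, ?_⟩
  have : (‖x‖ : ℂ) ≠ 0 := by exact_mod_cast norm_ne_zero_iff.2 hx
  simp [hg, this]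

/-- Functionals `f`, `g` with `ker f ⊆ ker g` are proportional. -/
theorem exists_smul_of_ker_le {f g : H →L[ℂ] ℂ} (h : ∀ v, f v = 0 → g v = 0) :
    ∃ c : ℂ, g = c • f := by
  by_cases hf : f = 0
  · refine ⟨0, ?_⟩
    ext v
    simp [h v (by simp [hf])]
  obtain ⟨v, hv⟩ : ∃ v, f v ≠ 0 := by
    by_contra hcon
    push Not at hcon
    exact hf (by ext v; simp [hcon])
  refine ⟨g v / f v, ?_⟩
  ext w
  have := h (w - (f w / f v) • v) (by simp [hv])
  simp only [map_sub, map_smul, smul_eq_mul, sub_eq_zero] at this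
  rw [this]
  simp only [smul_apply, smul_eq_mul]
  ring

theorem isTensorLike_rankOneBilin : IsTensorLike (rankOneBilin H) where
  eq_zero y g h := by
    by_cases hy : y = 0
    · exact Or.inl hy
    refine Or.inr ?_
    ext v
    have := DFunLike.congr_fun h v
    simpa [hy] using this
  left_of_eq y y' g g' h h0 := by
    obtain ⟨v, hv⟩ : ∃ v, g' v ≠ 0 := by
      by_contra hcon
      push Not at hcon
      exact h0 (by rw [h]; ext v; simp [hcon])
    have := DFunLike.congr_fun h v
    simp only [rankOneBilin_apply, ContinuousLinearMap.smulRight_apply] at this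
    exact ⟨(g' v)⁻¹ * g v, by rw [mul_smul, this, inv_smul_smul₀ hv]⟩
  right_of_eq y y' g g' h h0 := by
    have hy' : y' ≠ 0 := by
      rintro rfl
      exact h0 (by rw [h]; ext v; simp)
    refine exists_smul_of_ker_le fun v hv => ?_
    have := DFunLike.congr_fun h v
    simpa [hv, hy'] using this.symm
  of_add y y' y'' g g' g'' h hy hg := by
    by_cases hgg : ∃ c : ℂ, g' = c • g
    · exact Or.inr hgg
    by_cases hgg' : ∃ c : ℂ, g = c • g'
    · obtain ⟨c, rfl⟩ := hgg'
      have hc : c ≠ 0 := by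
        rintro rfl
        exact hg (by ext; simp)
      exact Or.inr ⟨c⁻¹, by simp [hc]⟩
    -- For independent functionals, evaluating where exactly one of them vanishes makes `y` and `y'`
    -- multiples of `y''`.
    have h1 : ∃ v, g v = 0 ∧ g' v ≠ 0 := by
      by_contra hcon
      push Not at hcon
      exact hgg (exists_smul_of_ker_le hcon)
    have h2 : ∃ v, g' v = 0 ∧ g v ≠ 0 := by
      by_contra hcon
      push Not at hcon
      exact hgg' (exists_smul_of_ker_le hcon)
    obtain ⟨⟨v, hv, hv'⟩, w, hw, hw'⟩ := And.intro h1 h2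
    have ev := DFunLike.congr_fun h v
    have ew := DFunLike.congr_fun h w
    simp only [rankOneBilin_apply, add_apply,
      ContinuousLinearMap.smulRight_apply, hv, hw, zero_smul, zero_add, add_zero] at ev ew
    have hw'' : g'' w ≠ 0 := by
      intro h0
      rw [h0, zero_smul] at ew
      exact (smul_ne_zero hw' hy) ew
    refine Or.inl ⟨(g' v)⁻¹ * g'' v * (g'' w)⁻¹ * g w, ?_⟩
    rw [mul_smul, ew, mul_smul, inv_smul_smul₀ hw'', mul_smul, ← ev, inv_smul_smul₀ hv']

/-- `1 + x ⊗ f` is invertible exactly when `f x ≠ -1`. -/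
theorem isUnit_one_add_smulRight_iff {x : H} {f : H →L[ℂ] ℂ} :
    IsUnit (1 + f.smulRight x : H →L[ℂ] H) ↔ f x ≠ -1 := by
  constructor
  · intro hu hfx
    obtain ⟨B, hB⟩ := hu.exists_left_inv
    have : (1 + f.smulRight x : H →L[ℂ] H) x = 0 := by simp [hfx]
    have hx : x = 0 := by
      have h := DFunLike.congr_fun hB x
      rw [mul_apply_eq_comp, this, map_zero] at h
      exact h.symm
    rw [hx, map_zero] at hfx
    norm_num at hfx
  · intro h
    have h' : 1 + f x ≠ 0 := fun h0 => h (by linear_combination h0)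
    refine ⟨⟨1 + f.smulRight x, 1 - (1 + f x)⁻¹ • f.smulRight x, ?_, ?_⟩, rfl⟩
    all_goals
      ext z
      simp only [mul_apply_eq_comp, add_apply,
        sub_apply, one_apply_eq_self,
        smul_apply, ContinuousLinearMap.smulRight_apply, map_sub, map_smul,
        map_add, smul_smul]
      rw [← sub_eq_zero]
      match_scalars
      · ring
      · field_simp; ring

/-- An algebraic characterization of operators of rank at most one. -/
theorem exists_eq_smulRight_iff {A : H →L[ℂ] H} :
    (∃ y g, A = (g : H →L[ℂ] ℂ).smulRight y) ↔ ∀ B : H →L[ℂ] H, ∃ c : ℂ, A * B * A = c • A := by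
  constructor
  · rintro ⟨y, g, rfl⟩ B
    refine ⟨g (B y), ?_⟩
    ext z
    simp [smul_smul, mul_comm]
  · intro h
    by_cases hA : A = 0
    · exact ⟨0, 0, by ext; simp [hA]⟩
    obtain ⟨u, hu⟩ : ∃ u, A u ≠ 0 := by
      by_contra hcon
      push Not at hcon
      exact hA (by ext v; simp [hcon])
    obtain ⟨g, hg⟩ := exists_functional_eq_one hu
    refine ⟨A u, g.comp A, ?_⟩
    ext v
    -- Since `g (A u) = 1`, this `B` gives `A * B * A` the value `A v` at `u`.
    obtain ⟨c, hc⟩ := h (g.smulRight v)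
    have := DFunLike.congr_fun hc u
    simp only [mul_apply_eq_comp, ContinuousLinearMap.smulRight_apply, hg, one_smul,
      smul_apply] at this
    simp [this, hg]

end RankOne

/-! ### Invertibility and spectra under automorphisms -/

section AlgAut

variable {A : Type*} [NormedRing A] [NormedSpace ℂ A] {τ : A →ₗ[ℂ] A}

theorem algAut_map_one (hτ : τ ∈ algAut A) : τ 1 = 1 := by
  obtain ⟨a, ha⟩ := hτ.1.2 1
  have := hτ.2 a 1
  rwa [mul_one, ha, one_mul, eq_comm] at this

theorem algAut_isUnit_iff (hτ : τ ∈ algAut A) (a : A) : IsUnit (τ a) ↔ IsUnit a := by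
  let e : A ≃* A := MulEquiv.ofBijective (⟨τ, hτ.2⟩ : A →ₙ* A) hτ.1
  exact MulEquiv.isUnit_map e

theorem algAut_mem_spectrum {A : Type*} [NormedRing A] [NormedAlgebra ℂ A] {τ : A →ₗ[ℂ] A}
    (hτ : τ ∈ algAut A) {a : A} {z : ℂ} : z ∈ spectrum ℂ (τ a) ↔ z ∈ spectrum ℂ a := by
  rw [spectrum.mem_iff, spectrum.mem_iff, ← algAut_isUnit_iff hτ (algebraMap ℂ A z - a),
    map_sub,
    Algebra.algebraMap_eq_smul_one, map_smul, algAut_map_one hτ]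

end AlgAut

/-! ### Scaled local automorphisms of B(H) are spatial -/

section SpatialMaps

variable {H : Type*} [NormedAddCommGroup H] [InnerProductSpace ℂ H]

/-- A bounded unital linear map which is locally a nonzero multiple of an automorphism. -/
structure IsScaledLocalAut (σ : (H →L[ℂ] H) →L[ℂ] (H →L[ℂ] H)) : Prop where
  map_one : σ 1 = 1
  exists_smul : ∀ A, ∃ c : ℂ, c ≠ 0 ∧ ∃ τ ∈ algAut (H →L[ℂ] H), σ A = c • τ A

theorem HilbertBasis.exists_ne_zero_of_functional (b : HilbertBasis ℕ ℂ H)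
    (g : H →L[ℂ] ℂ) : ∃ z, z ≠ 0 ∧ g z = 0 := by
  have hb : ∀ n, b n ≠ 0 := fun n => b.orthonormal.ne_zero n
  by_cases h : g (b 0) = 0
  · exact ⟨b 0, hb 0, h⟩
  · refine ⟨b 1 - (g (b 1) / g (b 0)) • b 0, fun h0 => ?_, by simp [h]⟩
    have := congrArg (inner ℂ (b 1)) h0
    rw [inner_sub_right, inner_smul_right, b.orthonormal.2 (by norm_num : (1 : ℕ) ≠ 0)] at this
    simp [hb] at this

namespace IsScaledLocalAut

variable {σ : (H →L[ℂ] H) →L[ℂ] (H →L[ℂ] H)}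

theorem isUnit_iff (hσ : IsScaledLocalAut σ) (A : H →L[ℂ] H) : IsUnit (σ A) ↔ IsUnit A := by
  obtain ⟨c, hc, τ, hτ, h⟩ := hσ.exists_smul A
  rw [h, ← algAut_isUnit_iff hτ A]
  exact isUnit_smul_iff (Units.mk0 c hc) (τ A)

theorem eq_zero (hσ : IsScaledLocalAut σ) {A : H →L[ℂ] H} (h0 : σ A = 0) : A = 0 := by
  obtain ⟨c, hc, τ, hτ, h⟩ := hσ.exists_smul A
  rw [h0, eq_comm, smul_eq_zero_iff_right hc] at h
  exact hτ.1.1 (by rw [h, map_zero])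

/-- A trivial right annihilator is an algebraic property, so it survives both `τ` and the nonzero
scalar; it stands in for injectivity. -/
theorem left_regular (hσ : IsScaledLocalAut σ) {A : H →L[ℂ] H} (hA : ∀ B, A * B = 0 → B = 0)
    (B : H →L[ℂ] H) (hB : σ A * B = 0) : B = 0 := by
  obtain ⟨c, hc, τ, hτ, h⟩ := hσ.exists_smul A
  obtain ⟨C, rfl⟩ := hτ.1.2 B
  rw [h, smul_mul_assoc, smul_eq_zero_iff_right hc, ← hτ.2] at hB
  rw [hA C (hτ.1.1 (by rw [hB, map_zero])), map_zero]

theorem right_regular (hσ : IsScaledLocalAut σ) {A : H →L[ℂ] H} (hA : ∀ B, B * A = 0 → B = 0)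
    (B : H →L[ℂ] H) (hB : B * σ A = 0) : B = 0 := by
  obtain ⟨c, hc, τ, hτ, h⟩ := hσ.exists_smul A
  obtain ⟨C, rfl⟩ := hτ.1.2 B
  rw [h, mul_smul_comm, smul_eq_zero_iff_right hc, ← hτ.2] at hB
  rw [hA C (hτ.1.1 (by rw [hB, map_zero])), map_zero]

theorem exists_smulRight (hσ : IsScaledLocalAut σ) (x : H) (f : H →L[ℂ] ℂ) :
    ∃ y g, σ (f.smulRight x) = (g : H →L[ℂ] ℂ).smulRight y := by
  obtain ⟨c, hc, τ, hτ, h⟩ := hσ.exists_smul (f.smulRight x)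
  rw [exists_eq_smulRight_iff]
  intro B
  obtain ⟨C, rfl⟩ := hτ.1.2 B
  obtain ⟨d, hd⟩ := exists_eq_smulRight_iff.1 ⟨x, f, rfl⟩ C
  refine ⟨c * d, ?_⟩
  rw [h, smul_mul_assoc, smul_mul_assoc, mul_smul_comm, ← hτ.2, ← hτ.2, hd, map_smul, smul_smul,
    smul_smul, smul_smul]
  congr 1
  ring

/-- The operator `1 + s • (x ⊗ f)` is singular exactly when `s * f x = -1`, and `σ` preserves
invertibility in both directions; varying `s` recovers the trace. -/
theorem trace_eq (hσ : IsScaledLocalAut σ) {x y : H} {f g : H →L[ℂ] ℂ}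
    (h : σ (f.smulRight x) = g.smulRight y) : g y = f x := by
  have key : ∀ s : ℂ, s * g y ≠ -1 ↔ s * f x ≠ -1 := by
    intro s
    have h1 : σ (1 + (s • f).smulRight x) = 1 + (s • g).smulRight y := by
      have e1 : (s • f).smulRight x = s • f.smulRight x := by ext; exact mul_smul _ _ _
      have e2 : (s • g).smulRight y = s • g.smulRight y := by ext; exact mul_smul _ _ _
      rw [map_add, hσ.map_one, e1, e2, map_smul, h]
    have h2 := hσ.isUnit_iff (1 + (s • f).smulRight x)
    rw [h1, isUnit_one_add_smulRight_iff, isUnit_one_add_smulRight_iff] at h2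
    simpa using h2
  by_cases hf : f x = 0
  · by_contra hg
    rw [hf] at hg
    refine (key (-(g y)⁻¹)).2 (by simp [hf]) ?_
    field_simp
  · have := not_iff_not.2 (key (-(f x)⁻¹))
    push Not at this
    have h3 := this.2 (by field_simp)
    field_simp at h3
    linear_combination -h3

variable [CompleteSpace H]

theorem weightedShift_annihilated {W : Type*} [NormedAddCommGroup W] [NormedSpace ℂ W]
    (σ : (H →L[ℂ] H) →L[ℂ] (H →L[ℂ] H)) (b : HilbertBasis ℕ ℂ H) (j : ℕ)
    (Λ : (H →L[ℂ] H) →L[ℂ] W)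
    (h : ∀ n (f : H →L[ℂ] ℂ), Λ (σ (f.smulRight (b (n + j)))) = 0) :
    Λ (σ (weightedShift b j)) = 0 := by
  have := (hasSum_weightedShift b j).mapL (Λ.comp σ)
  simp only [ContinuousLinearMap.comp_apply, h] at this
  exact this.unique hasSum_zero

/-- Degenerate images are impossible: with a common functional `g`, the image of the left regular
shift would kill a nonzero vector of ker `g`; a common vector contradicts right regularity in the
same way. -/
theorem exists_column_or_row (hσ : IsScaledLocalAut σ) (b : HilbertBasis ℕ ℂ H) :
    (∃ (U : H →ₗ[ℂ] H) (V : (H →L[ℂ] ℂ) →ₗ[ℂ] (H →L[ℂ] ℂ)),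
      ∀ x f, σ (f.smulRight x) = (V f).smulRight (U x)) ∨
    ∃ (U : H →ₗ[ℂ] (H →L[ℂ] ℂ)) (V : (H →L[ℂ] ℂ) →ₗ[ℂ] H),
      ∀ x f, σ (f.smulRight x) = (U x).smulRight (V f) := by
  have : Nontrivial H := ⟨b 0, 0, b.orthonormal.ne_zero 0⟩
  have : Nontrivial (H →L[ℂ] ℂ) := by
    obtain ⟨f, hf⟩ := exists_functional_eq_one (b.orthonormal.ne_zero 0)
    exact ⟨f, 0, by rintro rfl; simp at hf⟩
  refine isTensorLike_rankOneBilin.bilinear_pure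
    ((rankOneBilin H).compr₂ (σ : (H →L[ℂ] H) →ₗ[ℂ] (H →L[ℂ] H))) (fun x f => ?_)
    (fun x f h => ?_) (fun f => ?_) (fun g => ?_) fun y => ?_
  · exact hσ.exists_smulRight x f
  · exact isTensorLike_rankOneBilin.eq_zero x f (hσ.eq_zero h)
  · obtain ⟨z, hz, hfz⟩ := b.exists_ne_zero_of_functional f
    obtain ⟨f', hf'⟩ := exists_functional_eq_one hz
    refine ⟨f', fun c hc => ?_⟩
    rw [hc] at hf'
    simp [hfz] at hf'
  · by_contra hcon
    push Not at hcon
    obtain ⟨z, hz, hgz⟩ := b.exists_ne_zero_of_functional g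
    obtain ⟨f', hf'⟩ := exists_functional_eq_one hz
    have h0 : σ (weightedShift b 0) z = 0 :=
      weightedShift_annihilated σ b 0 (ContinuousLinearMap.apply ℂ H z) fun n f => by
        obtain ⟨y, hy⟩ := hcon (b (n + 0)) f
        have : σ (f.smulRight (b (n + 0))) = g.smulRight y := hy
        rw [this]; simp [hgz]
    have := hσ.left_regular (isLeftRegular_weightedShift b 0) (f'.smulRight z)
      (by ext w; simp [h0])
    have := DFunLike.congr_fun this z
    simp [hf', hz] at this
  · by_contra hcon
    push Not at hcon
    obtain ⟨w, hw, hyw⟩ := b.exists_ne_zero_of_functional (innerSL ℂ y)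
    have h0 : (innerSL ℂ w).comp (σ (weightedShift b 0)) = 0 :=
      weightedShift_annihilated σ b 0 (ContinuousLinearMap.compL ℂ H H ℂ (innerSL ℂ w))
        fun n f => by
          obtain ⟨g, hg⟩ := hcon (b (n + 0)) f
          have : σ (f.smulRight (b (n + 0))) = g.smulRight y := hg
          have hwy : inner ℂ w y = 0 := inner_eq_zero_symm.1 (by simpa using hyw)
          ext v
          rw [this]; simp [hwy]
    have := hσ.right_regular (isRightRegular_weightedShift b) ((innerSL ℂ w).smulRight w) (by
      ext v
      have := DFunLike.congr_fun h0 v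
      simp only [ContinuousLinearMap.comp_apply] at this
      simp [this])
    have := DFunLike.congr_fun this w
    simp [hw] at this

/-- In the transposed form, trace preservation makes `σ (b (n + 1) ⊗ f)` kill the nonzero vector `V
(innerSL ℂ (b 0))`. So does `σ (weightedShift b 1)`, although that shift is left regular. -/
theorem exists_column (hσ : IsScaledLocalAut σ) (b : HilbertBasis ℕ ℂ H) :
    ∃ (U : H →ₗ[ℂ] H) (V : (H →L[ℂ] ℂ) →ₗ[ℂ] (H →L[ℂ] ℂ)),
      ∀ x f, σ (f.smulRight x) = (V f).smulRight (U x) := by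
  refine (hσ.exists_column_or_row b).resolve_right ?_
  rintro ⟨U, V, h⟩
  set z := V (innerSL ℂ (b 0)) with hz
  have htr : U (b 0) z = 1 := by
    rw [hσ.trace_eq (h _ _)]
    simp [b.orthonormal.1]
  have hz0 : z ≠ 0 := by
    intro h0
    simp [h0] at htr
  obtain ⟨f', hf'⟩ := exists_functional_eq_one hz0
  have h0 : σ (weightedShift b 1) z = 0 :=
    weightedShift_annihilated σ b 1 (ContinuousLinearMap.apply ℂ H z) fun n f => by
      have : U (b (n + 1)) z = 0 := by
        rw [hz, hσ.trace_eq (h _ _)]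
        exact b.orthonormal.2 (by omega)
      simp [h, this]
  have := hσ.left_regular (isLeftRegular_weightedShift b 1) (f'.smulRight z)
    (by ext w; simp [h0])
  have := DFunLike.congr_fun this z
  simp [hf', hz0] at this

/-- On operators of rank one, `σ` is implemented by an invertible operator. -/
theorem exists_equiv_rankOne (hσ : IsScaledLocalAut σ) (b : HilbertBasis ℕ ℂ H) :
    ∃ U : H ≃L[ℂ] H, ∀ x (f : H →L[ℂ] ℂ),
      σ (f.smulRight x) = (f.comp (U.symm : H →L[ℂ] H)).smulRight (U x) := by
  obtain ⟨U, V, h⟩ := hσ.exists_column b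
  have htr : ∀ x f, V f (U x) = f x := fun x f => hσ.trace_eq (h x f)
  have hb0 := b.orthonormal.ne_zero 0
  -- Fixing one variable bounds the map in the other.
  have hnorm : ∀ x f, ‖V f‖ * ‖U x‖ ≤ ‖σ‖ * (‖f‖ * ‖x‖) := by
    intro x f
    rw [← ContinuousLinearMap.norm_smulRight_apply, ← h,
      ← ContinuousLinearMap.norm_smulRight_apply]
    exact σ.le_opNorm _
  have hU : ∀ x, U x = 0 → x = 0 := by
    intro x hx
    by_contra hne
    obtain ⟨f, hf⟩ := exists_functional_eq_one hne
    rw [← htr, hx, map_zero] at hf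
    exact zero_ne_one hf
  obtain ⟨f₀, hf₀⟩ := exists_functional_eq_one hb0
  have hVf₀ : 0 < ‖V f₀‖ := by
    rw [norm_pos_iff]
    intro h0
    rw [← htr, h0] at hf₀
    simp at hf₀
  have hUb0 : 0 < ‖U (b 0)‖ := norm_pos_iff.2 fun h0 => hb0 (hU _ h0)
  let Uc : H →L[ℂ] H := U.mkContinuous (‖σ‖ * ‖f₀‖ / ‖V f₀‖) fun x => by
    rw [div_mul_eq_mul_div, le_div_iff₀ hVf₀]
    linarith [hnorm x f₀]
  set C := ‖σ‖ * ‖b 0‖ / ‖U (b 0)‖ with hC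
  have hC0 : 0 ≤ C := by positivity
  have hV : ∀ f, ‖V f‖ ≤ C * ‖f‖ := by
    intro f
    rw [hC, div_mul_eq_mul_div, le_div_iff₀ hUb0]
    linarith [hnorm (b 0) f]
  have hanti : AntilipschitzWith ⟨C, hC0⟩ Uc := by
    refine AddMonoidHomClass.antilipschitz_of_bound Uc fun x => ?_
    obtain ⟨g, hg, hgx⟩ := exists_dual_vector'' ℂ x
    calc ‖x‖ = ‖g x‖ := by rw [hgx]; simp
      _ = ‖V g (U x)‖ := by rw [htr]
      _ ≤ ‖V g‖ * ‖U x‖ := (V g).le_opNorm _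
      _ ≤ C * ‖U x‖ := by
        gcongr
        exact (hV g).trans (mul_le_of_le_one_right hC0 hg)
  have hclosed : IsClosed (Uc.range : Set H) := hanti.isClosed_range Uc.uniformContinuous
  -- The range is closed; a nonzero vector orthogonal to it would destroy right regularity of the
  -- image of the shift.
  have hrange : Uc.range = ⊤ := by
    have : CompleteSpace Uc.range := hclosed.completeSpace_coe
    rw [← Submodule.orthogonal_eq_bot_iff, Submodule.eq_bot_iff]
    intro w hw
    by_contra hw0
    rw [Submodule.mem_orthogonal] at hw
    have hwU : ∀ x, inner ℂ w (U x) = 0 := fun x =>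
      inner_eq_zero_symm.1 (hw (U x) ⟨x, rfl⟩)
    have h0 : (innerSL ℂ w).comp (σ (weightedShift b 0)) = 0 :=
      weightedShift_annihilated σ b 0 (ContinuousLinearMap.compL ℂ H H ℂ (innerSL ℂ w))
        fun n f => by
          ext v
          simp [h, hwU]
    have := hσ.right_regular (isRightRegular_weightedShift b) ((innerSL ℂ w).smulRight w) (by
      ext v
      have := DFunLike.congr_fun h0 v
      simp only [ContinuousLinearMap.comp_apply] at this
      simp [this])
    have := DFunLike.congr_fun this w
    simp [hw0] at this
  have hker : Uc.ker = ⊥ := LinearMap.ker_eq_bot'.2 hU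
  let e := ContinuousLinearEquiv.ofBijective Uc hker hrange
  have he : ∀ x, e x = U x := fun x => rfl
  refine ⟨e, fun x f => ?_⟩
  rw [h, he]
  congr 1
  ext w
  obtain ⟨v, rfl⟩ := e.surjective w
  rw [he, htr, ← he]
  simp

end IsScaledLocalAut

/-- Operators with the same invertible rank one perturbations are equal. -/
theorem eq_of_isUnit_add_smulRight {A B : H →L[ℂ] H} (hA : IsUnit A)
    (h : ∀ x (f : H →L[ℂ] ℂ), IsUnit (A + f.smulRight x) ↔ IsUnit (B + f.smulRight x)) :
    A = B := by
  have hB : IsUnit B := by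
    have := h 0 0
    simpa [hA] using this
  obtain ⟨a, rfl⟩ := hA
  obtain ⟨c, rfl⟩ := hB
  have fac : ∀ (u : (H →L[ℂ] H)ˣ) x (f : H →L[ℂ] ℂ),
      IsUnit ((u : H →L[ℂ] H) + f.smulRight x) ↔ f ((u⁻¹ : (H →L[ℂ] H)ˣ).1 x) ≠ -1 := by
    intro u x f
    have : (u : H →L[ℂ] H) * (1 + f.smulRight ((u⁻¹ : (H →L[ℂ] H)ˣ).1 x)) =
        (u : H →L[ℂ] H) + f.smulRight x := by
      ext z
      have h1 : (u : H →L[ℂ] H) ((u⁻¹ : (H →L[ℂ] H)ˣ).1 x) = x :=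
        DFunLike.congr_fun u.mul_inv x
      simp [h1]
    rw [← isUnit_one_add_smulRight_iff, ← this, Units.isUnit_units_mul]
  have key : ∀ x (f : H →L[ℂ] ℂ),
      f ((a⁻¹ : (H →L[ℂ] H)ˣ).1 x) = -1 ↔ f ((c⁻¹ : (H →L[ℂ] H)ˣ).1 x) = -1 := by
    intro x f
    have := h x f
    rw [fac, fac] at this
    exact not_iff_not.1 this
  have heq : ∀ x, (a⁻¹ : (H →L[ℂ] H)ˣ).1 x = (c⁻¹ : (H →L[ℂ] H)ˣ).1 x := by
    intro x
    by_contra hne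
    obtain ⟨f, hf⟩ := exists_functional_eq_one (sub_ne_zero.2 hne)
    rw [map_sub] at hf
    by_cases h0 : f ((a⁻¹ : (H →L[ℂ] H)ˣ).1 x) = 0
    · have := (key x f).2 (by linear_combination -hf + h0)
      rw [h0] at this
      norm_num at this
    · have := (key x (-(f ((a⁻¹ : (H →L[ℂ] H)ˣ).1 x))⁻¹ • f)).1 (by simp [h0])
      simp only [smul_apply, smul_eq_mul] at this
      field_simp at this
      have h2 : f ((c⁻¹ : (H →L[ℂ] H)ˣ).1 x) = f ((a⁻¹ : (H →L[ℂ] H)ˣ).1 x) := by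
        linear_combination -this
      rw [h2, sub_self] at hf
      exact zero_ne_one hf
  have : a⁻¹ = c⁻¹ := Units.ext (ContinuousLinearMap.ext heq)
  rw [inv_injective this]

namespace IsScaledLocalAut

variable {σ : (H →L[ℂ] H) →L[ℂ] (H →L[ℂ] H)} [CompleteSpace H]

/-- A bounded unital linear map which is locally a multiple of an automorphism is spatial. -/
theorem exists_conj (hσ : IsScaledLocalAut σ) (b : HilbertBasis ℕ ℂ H) :
    ∃ U : H ≃L[ℂ] H, ∀ A, σ A = (U : H →L[ℂ] H) * A * (U.symm : H →L[ℂ] H) := by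
  obtain ⟨U, hU⟩ := hσ.exists_equiv_rankOne b
  refine ⟨U, ?_⟩
  let u : (H →L[ℂ] H)ˣ := ⟨U, U.symm, by ext; simp, by ext; simp⟩
  have hrank : ∀ x (f : H →L[ℂ] ℂ),
      σ (f.smulRight x) = (u : H →L[ℂ] H) * f.smulRight x * (u⁻¹ : (H →L[ℂ] H)ˣ).1 := by
    intro x f
    rw [hU]
    ext z
    simp [u]
  have hinv : ∀ A, IsUnit A → σ A = (u : H →L[ℂ] H) * A * (u⁻¹ : (H →L[ℂ] H)ˣ).1 := by
    intro A hA
    -- The two sides have the same invertible rank one perturbations, because `σ` is already known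
    -- on rank one.
    have : A = (u⁻¹ : (H →L[ℂ] H)ˣ).1 * σ A * u := by
      refine eq_of_isUnit_add_smulRight hA fun x f => ?_
      rw [← hσ.isUnit_iff, map_add, hrank, ← Units.isUnit_units_mul u⁻¹, ← Units.isUnit_mul_units _ u]
      congr! 1
      simp only [mul_add, add_mul, mul_assoc, Units.inv_mul, mul_one, Units.inv_mul_cancel_left]
    conv_rhs => rw [this]
    simp only [mul_assoc, Units.mul_inv, mul_one, Units.mul_inv_cancel_left]
  intro A
  obtain ⟨c, hc⟩ : ∃ c : ℂ, IsUnit (c • 1 - A) := by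
    obtain ⟨c, hc⟩ : ∃ c : ℂ, ‖A‖ * ‖(1 : H →L[ℂ] H)‖ < ‖c‖ :=
      NormedField.exists_lt_norm ℂ _
    refine ⟨c, ?_⟩
    have := spectrum.mem_resolventSet_of_norm_lt_mul hc
    rwa [spectrum.mem_resolventSet_iff, Algebra.algebraMap_eq_smul_one] at this
  have h1 := hinv _ hc
  rw [map_sub, map_smul, hσ.map_one, mul_sub, sub_mul, mul_smul_comm, smul_mul_assoc, mul_one,
    Units.mul_inv] at h1
  exact sub_right_injective h1

theorem mem_algAut (hσ : IsScaledLocalAut σ) (b : HilbertBasis ℕ ℂ H) :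
    (σ : (H →L[ℂ] H) →ₗ[ℂ] (H →L[ℂ] H)) ∈ algAut (H →L[ℂ] H) := by
  obtain ⟨U, hU⟩ := hσ.exists_conj b
  refine ⟨⟨(injective_iff_map_eq_zero _).2 fun A hA => hσ.eq_zero hA, fun A =>
    ⟨(U.symm : H →L[ℂ] H) * A * (U : H →L[ℂ] H), ?_⟩⟩, fun A B => ?_⟩
  · change σ _ = _
    rw [hU]
    ext z
    simp
  · change σ _ = σ _ * σ _
    rw [hU, hU, hU]
    ext z
    simp

/-- Rank one operators yield ‖U‖ ‖U⁻¹‖ ≤ ‖σ‖, and A = U⁻¹ σ(A) U. The constant depends on ‖σ‖ alone,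
which makes it uniform over the fibres. -/
theorem norm_le (hσ : IsScaledLocalAut σ) (b : HilbertBasis ℕ ℂ H) (A : H →L[ℂ] H) :
    ‖A‖ ≤ ‖σ‖ * ‖σ A‖ := by
  obtain ⟨U, hU⟩ := hσ.exists_conj b
  have key : ∀ x y, ‖U.symm y‖ * ‖U x‖ ≤ ‖σ‖ * ‖x‖ * ‖y‖ := by
    intro x y
    obtain ⟨g, hg, hgy⟩ := exists_dual_vector'' ℂ (U.symm y)
    have h1 : σ (g.smulRight x) y = g (U.symm y) • U x := by
      rw [hU]
      simp
    calc ‖U.symm y‖ * ‖U x‖ = ‖σ (g.smulRight x) y‖ := by rw [h1, norm_smul, hgy]; simp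
      _ ≤ ‖σ‖ * ‖g.smulRight x‖ * ‖y‖ :=
        (ContinuousLinearMap.le_opNorm _ _).trans (by gcongr; exact σ.le_opNorm _)
      _ ≤ ‖σ‖ * ‖x‖ * ‖y‖ := by
        rw [ContinuousLinearMap.norm_smulRight_apply]
        gcongr
        exact mul_le_of_le_one_left (norm_nonneg _) hg
  refine ContinuousLinearMap.opNorm_le_bound _ (by positivity) fun x => ?_
  by_cases hx : x = 0
  · simp [hx]
  have hUx : 0 < ‖U x‖ := by simpa using hx
  have h1 : σ A (U x) = U (A x) := by rw [hU]; simp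
  have h2 := key x (σ A (U x))
  rw [h1, U.symm_apply_apply, ← h1] at h2
  refine le_of_mul_le_mul_right (h2.trans ?_) hUx
  calc ‖σ‖ * ‖x‖ * ‖σ A (U x)‖ ≤ ‖σ‖ * ‖x‖ * (‖σ A‖ * ‖U x‖) := by
        gcongr; exact (σ A).le_opNorm _
    _ = _ := by ring

end IsScaledLocalAut

end SpatialMaps

/-! ### Functions vanishing at infinity: composition and norms -/

namespace ZeroAtInftyContinuousMap

variable {X : Type*} [TopologicalSpace X]

section Map

variable {V W : Type*} [NormedAddCommGroup V] [NormedAddCommGroup W]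

/-- Composition with a map fixing `0` and continuous at `0` and on the range. -/
def postcomp (f : C₀(X, V)) (φ : V → W) (hφ : ∀ x, ContinuousAt φ (f x)) (h : ContinuousAt φ 0)
    (h0 : φ 0 = 0) : C₀(X, W) where
  toFun x := φ (f x)
  continuous_toFun := continuous_iff_continuousAt.2 fun x =>
    (hφ x).comp (map_continuous f).continuousAt
  zero_at_infty' := by
    have := h.tendsto.comp (zero_at_infty f)
    rwa [h0] at this

@[simp]
theorem postcomp_apply (f : C₀(X, V)) (φ : V → W) (hφ h h0) (x : X) :
    f.postcomp φ hφ h h0 x = φ (f x) := rfl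

theorem norm_apply_le (f : C₀(X, V)) (x : X) : ‖f x‖ ≤ ‖f‖ :=
  f.toBCF.norm_coe_le_norm x

theorem norm_le_of_forall {f : C₀(X, V)} {C : ℝ} (hC : 0 ≤ C) (h : ∀ x, ‖f x‖ ≤ C) : ‖f‖ ≤ C :=
  (BoundedContinuousFunction.norm_le (f := f.toBCF) hC).2 h

/-- The function `x ↦ ‖f x‖`, with complex values. -/
noncomputable def normC (f : C₀(X, V)) : C₀(X, ℂ) :=
  f.postcomp (fun v => (‖v‖ : ℂ)) (fun _ => by fun_prop) (by fun_prop) (by simp)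

@[simp]
theorem normC_apply (f : C₀(X, V)) (x : X) : f.normC x = (‖f x‖ : ℂ) := rfl

variable [NormedSpace ℂ V] [NormedSpace ℂ W]

/-- Composition with a continuous linear map. -/
noncomputable def mapCLM (X : Type*) [TopologicalSpace X] (L : V →L[ℂ] W) :
    C₀(X, V) →L[ℂ] C₀(X, W) :=
  LinearMap.mkContinuous
    { toFun := fun f => f.postcomp L (fun _ => L.continuous.continuousAt) L.continuous.continuousAt
        (map_zero L)
      map_add' := fun f g => by ext x; simp
      map_smul' := fun c f => by ext x; simp } ‖L‖ fun f =>
    norm_le_of_forall (by positivity) fun x =>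
      (L.le_opNorm _).trans (by gcongr; exact f.norm_apply_le x)

@[simp]
theorem mapCLM_apply (L : V →L[ℂ] W) (f : C₀(X, V)) (x : X) : mapCLM X L f x = L (f x) := rfl

variable (X) in
/-- The map `f ↦ f ⊗ v`. -/
noncomputable def tens (v : V) : C₀(X, ℂ) →L[ℂ] C₀(X, V) :=
  mapCLM X ((ContinuousLinearMap.id ℂ ℂ).smulRight v)

@[simp]
theorem tens_apply (v : V) (f : C₀(X, ℂ)) (x : X) : tens X v f x = f x • v := rfl

end Map

/-! ### Characters and automorphisms of C₀(X) -/

section Character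

/-- A multiplicative functional cannot equal `1` at a function of norm at most `1 / 2`. -/
theorem character_ne_one (χ : C₀(X, ℂ) →ₗ[ℂ] ℂ) (hχ : ∀ f g, χ (f * g) = χ f * χ g)
    {u : C₀(X, ℂ)} (hu : ∀ x, ‖u x‖ ≤ 1 / 2) : χ u ≠ 1 := by
  intro h1
  have hne : ∀ x, 1 - u x ≠ 0 := fun x h0 => by
    have := hu x
    rw [← sub_eq_zero.1 h0] at this
    norm_num at this
  let v : C₀(X, ℂ) := u.postcomp (fun z => z / (1 - z))
    (fun x => ContinuousAt.div (by fun_prop) (by fun_prop) (hne x))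
    (ContinuousAt.div (by fun_prop) (by fun_prop) (by simp)) (by simp)
  have hv : v - u * v = u := by
    ext x
    have := hne x
    simp only [v, sub_apply, mul_apply, postcomp_apply]
    field_simp
  have := congrArg χ hv
  rw [map_sub, hχ, h1] at this
  simp at this

variable [LocallyCompactSpace X] [T2Space X]

theorem exists_urysohn {s t : Set X} (hs : IsCompact s) (ht : IsClosed t) (hst : Disjoint s t) :
    ∃ f : C₀(X, ℂ), (∀ x ∈ s, f x = 1) ∧ (∀ x ∈ t, f x = 0) ∧ ∀ x, ‖f x‖ ≤ 1 := by
  obtain ⟨f, h1, h0, hc, hI⟩ := exists_continuous_one_zero_of_isCompact hs ht hst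
  refine ⟨⟨⟨fun x => (f x : ℂ), by fun_prop⟩, ?_⟩, fun x hx => ?_, fun x hx => ?_, fun x => ?_⟩
  · have : HasCompactSupport fun x => (f x : ℂ) := hc.comp_left (g := fun r : ℝ => (r : ℂ)) (by simp)
    exact this.is_zero_at_infty
  · have := h1 hx
    change ((f x : ℝ) : ℂ) = 1
    rw [this]; simp
  · have := h0 hx
    change ((f x : ℝ) : ℂ) = 0
    rw [this]; simp
  · change ‖((f x : ℝ) : ℂ)‖ ≤ 1
    rw [Complex.norm_real, Real.norm_of_nonneg (hI x).1]
    exact (hI x).2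

theorem exists_eventually_one (y : X) :
    ∃ f : C₀(X, ℂ), (∀ᶠ x in nhds y, f x = 1) ∧ ∀ x, ‖f x‖ ≤ 1 := by
  obtain ⟨K, hK, hy⟩ := exists_compact_mem_nhds y
  obtain ⟨f, h1, -, h⟩ := exists_urysohn hK isClosed_empty (Set.disjoint_empty K)
  exact ⟨f, Filter.mem_of_superset hy h1, h⟩

theorem exists_apply_eq_one (y : X) : ∃ f : C₀(X, ℂ), f y = 1 := by
  obtain ⟨f, h, -⟩ := exists_eventually_one y
  exact ⟨f, h.self_of_nhds⟩

theorem eq_of_forall_apply_eq {a b : X} (h : ∀ f : C₀(X, ℂ), f a = f b) : a = b := by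
  by_contra hab
  obtain ⟨f, h1, h0, -⟩ := exists_urysohn (isCompact_singleton (x := a))
    (isClosed_singleton (x := b)) (by simpa using hab)
  have := h f
  rw [h1 a rfl, h0 b rfl] at this
  exact one_ne_zero this

/-- The nonzero multiplicative linear functionals on `C₀(X, ℂ)` are the point evaluations. -/
theorem exists_eval_of_character (χ : C₀(X, ℂ) →ₗ[ℂ] ℂ) (hχ : ∀ f g, χ (f * g) = χ f * χ g)
    (hne : ∃ f, χ f ≠ 0) : ∃ y, ∀ f, χ f = f y := by
  by_contra hcon
  push Not at hcon
  obtain ⟨g, hg⟩ : ∃ g, χ g = 1 := by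
    obtain ⟨f, hf⟩ := hne
    exact ⟨(χ f)⁻¹ • f, by simp [hf]⟩
  have hzero : ∀ y, ∃ f : C₀(X, ℂ), χ f = 0 ∧ f y ≠ 0 := by
    intro y
    by_contra hall
    push Not at hall
    -- Evaluation at `y` is then proportional to `χ`, and multiplicativity makes them equal.
    have hy : ∀ f : C₀(X, ℂ), f y = χ f * g y := fun f => by
      have := hall (f - χ f • g) (by simp [hg])
      simpa [sub_eq_zero] using this
    have hgg := hy (g * g)
    rw [hχ, hg, mul_apply] at hgg
    have h1 : g y = 1 := by
      obtain ⟨f, hf⟩ := exists_apply_eq_one y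
      have h0 : g y ≠ 0 := by
        intro h0
        have := hy f
        rw [hf, h0, mul_zero] at this
        exact one_ne_zero this
      exact mul_left_cancel₀ h0 (by linear_combination hgg)
    obtain ⟨f, hf⟩ := hcon y
    exact hf (by rw [hy f, h1, mul_one])
  choose k hk0 hk using hzero
  -- Only on `K` must `g` be made smaller. There `h`, a finite sum of |k_y|² in ker `χ`, is at least
  -- `δ`. Then `w = h / (h + ε)` is also in ker `χ`, and `g - g * w = g * ε / (h + ε)` has norm at
  -- most 1/2 and `χ`-value 1.
  let K : Set X := {x | 1 / 2 ≤ ‖g x‖}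
  have hK : IsCompact K := by
    have h : ∀ᶠ x in Filter.cocompact X, ‖g x‖ < 1 / 2 := by
      have := (zero_at_infty g).norm
      rw [norm_zero] at this
      exact this.eventually_lt_const (by norm_num)
    obtain ⟨t, ht, hts⟩ := Filter.mem_cocompact.1 h
    refine ht.of_isClosed_subset (isClosed_le continuous_const (map_continuous g).norm) ?_
    intro x hx
    by_contra hxt
    exact not_lt.2 (show 1 / 2 ≤ ‖g x‖ from hx) (show ‖g x‖ < 1 / 2 from hts hxt)
  obtain ⟨s, -, hs⟩ := hK.elim_nhds_subcover (fun y => {x | k y x ≠ 0}) fun y _ =>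
    (isOpen_ne_fun (map_continuous (k y)) continuous_const).mem_nhds (hk y)
  let h : C₀(X, ℂ) := ∑ y ∈ s, star (k y) * k y
  let r : X → ℝ := fun x => ∑ y ∈ s, ‖k y x‖ ^ 2
  have hr : ∀ x, h x = (r x : ℂ) := by
    intro x
    have : h x = ∑ y ∈ s, (star (k y) * k y) x := by
      have := map_sum (⟨⟨fun f => f x, rfl⟩, fun _ _ => rfl⟩ : C₀(X, ℂ) →+ ℂ) (fun y => star (k y) * k y) s
      exact this
    rw [this]
    simp only [r, Complex.ofReal_sum]
    refine Finset.sum_congr rfl fun y _ => ?_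
    rw [mul_apply, star_apply, Complex.star_def, ← Complex.normSq_eq_conj_mul_self,
      Complex.normSq_eq_norm_sq]
  have hr0 : ∀ x, 0 ≤ r x := fun x => Finset.sum_nonneg fun y _ => by positivity
  have hrc : Continuous r := by
    refine continuous_finsetSum _ fun y _ => ?_
    exact ((map_continuous (k y)).norm).pow 2
  have hχh : χ h = 0 := by
    rw [map_sum]
    exact Finset.sum_eq_zero fun y _ => by rw [hχ, hk0, mul_zero]
  obtain ⟨δ, hδ, hδK⟩ : ∃ δ > 0, ∀ x ∈ K, δ ≤ r x := by
    rcases K.eq_empty_or_nonempty with hE | hN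
    · exact ⟨1, one_pos, by simp [hE]⟩
    obtain ⟨x₀, hx₀, hmin⟩ := hK.exists_isMinOn hN hrc.continuousOn
    refine ⟨r x₀, ?_, fun x hx => hmin hx⟩
    obtain ⟨y, hy⟩ := Set.mem_iUnion.1 (hs hx₀)
    obtain ⟨hys, hy⟩ := Set.mem_iUnion.1 hy
    refine Finset.sum_pos' (fun y _ => by positivity) ⟨y, hys, ?_⟩
    have : 0 < ‖k y x₀‖ := norm_pos_iff.2 hy
    positivity
  set ε : ℝ := δ / (2 * ‖g‖ + 1) with hε
  have hε0 : 0 < ε := by positivity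
  have hden : ∀ x, h x + ε ≠ 0 := fun x => by
    rw [hr, ← Complex.ofReal_add, Ne, Complex.ofReal_eq_zero]
    linarith [hr0 x]
  let w : C₀(X, ℂ) := h.postcomp (fun z => z / (z + ε))
    (fun x => ContinuousAt.div (by fun_prop) (by fun_prop) (hden x))
    (ContinuousAt.div (by fun_prop) (by fun_prop) (by simp [hε0.ne'])) (by simp)
  have hw : χ w = 0 := by
    have : h = w * h + (ε : ℂ) • w := by
      ext x
      have := hden x
      simp only [w, add_apply, mul_apply, postcomp_apply, smul_apply, smul_eq_mul]
      field_simp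
    have := congrArg χ this
    rw [map_add, hχ, hχh, map_smul, mul_zero, zero_add, smul_eq_mul] at this
    exact (mul_eq_zero.1 this.symm).resolve_left (by exact_mod_cast hε0.ne')
  refine character_ne_one χ hχ (u := g - g * w) (fun x => ?_) (by rw [map_sub, hχ, hw, hg]; simp)
  have hux : (g - g * w) x = g x * ((ε / (r x + ε) : ℝ) : ℂ) := by
    have := hden x
    rw [hr] at this
    simp only [w, sub_apply, mul_apply, postcomp_apply, hr]
    push_cast
    field_simp
    ring
  have hpos : 0 < r x + ε := by linarith [hr0 x]
  rw [hux, norm_mul, Complex.norm_real, Real.norm_of_nonneg (by positivity)]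
  by_cases hx : x ∈ K
  · have h1 := hδK x hx
    have h2 := g.norm_apply_le x
    rw [mul_div_assoc', div_le_div_iff₀ hpos two_pos]
    have h3 : ε * (2 * ‖g‖ + 1) = δ := by rw [hε]; field_simp
    nlinarith [norm_nonneg (g x)]
  · have h1 : ‖g x‖ < 1 / 2 := not_le.1 hx
    have h2 : ε / (r x + ε) ≤ 1 := (div_le_one hpos).2 (by linarith [hr0 x])
    nlinarith [norm_nonneg (g x)]

/-- Automorphisms of `C₀(X, ℂ)` are composition operators. -/
theorem exists_equiv_of_algAut {t : C₀(X, ℂ) →ₗ[ℂ] C₀(X, ℂ)} (ht : t ∈ algAut C₀(X, ℂ)) :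
    ∃ φ : X ≃ X, ∀ f x, t f x = f (φ x) := by
  have key : ∀ s : C₀(X, ℂ) →ₗ[ℂ] C₀(X, ℂ), s ∈ algAut C₀(X, ℂ) →
      ∃ φ : X → X, ∀ x f, s f x = f (φ x) := by
    intro s hs
    have : ∀ x, ∃ y, ∀ f, s f x = f y := by
      intro x
      refine exists_eval_of_character
        { toFun := fun f => s f x
          map_add' := fun f g => by simp
          map_smul' := fun c f => by simp } (fun f g => ?_) ?_
      · change s (f * g) x = s f x * s g x
        rw [hs.2, mul_apply]
      · obtain ⟨g, hg⟩ := exists_apply_eq_one x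
        obtain ⟨f, rfl⟩ := hs.1.2 g
        exact ⟨f, by change s f x ≠ 0; rw [hg]; exact one_ne_zero⟩
    choose φ hφ using this
    exact ⟨φ, hφ⟩
  let e := LinearEquiv.ofBijective t ht.1
  have he : ∀ f, t f = e f := fun _ => rfl
  have hs : (e.symm : C₀(X, ℂ) →ₗ[ℂ] C₀(X, ℂ)) ∈ algAut C₀(X, ℂ) := by
    refine ⟨e.symm.bijective, fun a b => ?_⟩
    change e.symm (a * b) = e.symm a * e.symm b
    rw [e.symm_apply_eq, ← he, ht.2, he, he, e.apply_symm_apply, e.apply_symm_apply]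
  obtain ⟨φ, hφ⟩ := key t ht
  obtain ⟨ψ, hψ⟩ := key _ hs
  refine ⟨⟨φ, ψ, fun x => ?_, fun x => ?_⟩, fun f x => hφ x f⟩
  · refine eq_of_forall_apply_eq fun f => ?_
    rw [← hψ, ← hφ, he]
    change e (e.symm f) x = _
    rw [e.apply_symm_apply]
  · refine eq_of_forall_apply_eq fun f => ?_
    rw [← hφ, ← hψ, he]
    change e.symm (e f) x = _
    rw [e.symm_apply_apply]

end Character

end ZeroAtInftyContinuousMap

/-! ### Center and fibres of C₀(X, B(H)) -/

namespace ZeroAtInftyContinuousMap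

variable {X : Type*} [TopologicalSpace X]
  {H : Type*} [NormedAddCommGroup H] [InnerProductSpace ℂ H]

theorem tens_mul (A B : H →L[ℂ] H) (f g : C₀(X, ℂ)) :
    tens X A f * tens X B g = tens X (A * B) (f * g) := by
  ext x : 1
  exact smul_mul_smul_comm (f x) A (g x) B

/-- The diagonal coefficient of an operator function at the vector `e`. -/
noncomputable def coeff (X : Type*) [TopologicalSpace X] (e : H) :
    C₀(X, H →L[ℂ] H) →L[ℂ] C₀(X, ℂ) :=
  mapCLM X ((innerSL ℂ e).comp (ContinuousLinearMap.apply ℂ H e))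

@[simp]
theorem coeff_apply (e : H) (F : C₀(X, H →L[ℂ] H)) (x : X) :
    coeff X e F x = inner ℂ e (F x e) := rfl

theorem coeff_tens_one {e : H} (he : ‖e‖ = 1) (f : C₀(X, ℂ)) :
    coeff X e (tens X (1 : H →L[ℂ] H) f) = f := by
  ext x
  simp [he]

section

variable [LocallyCompactSpace X] [T2Space X]

/-- The center of `C₀(X, B(H))` consists of the scalar functions. -/
theorem eq_tens_one_of_commute {e : H} (he : ‖e‖ = 1) {Z : C₀(X, H →L[ℂ] H)}
    (hZ : ∀ G, Z * G = G * Z) : Z = tens X (1 : H →L[ℂ] H) (coeff X e Z) := by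
  ext x w
  obtain ⟨f, hf⟩ := exists_apply_eq_one x
  have h := DFunLike.congr_fun (hZ (tens X ((innerSL ℂ e).smulRight w) f)) x
  simp only [mul_apply, tens_apply, hf, one_smul] at h
  have := DFunLike.congr_fun h e
  simpa [he] using this

/-- Automorphisms of `C₀(X, B(H))` act on the center by automorphisms of `C₀(X, ℂ)`. -/
theorem exists_central_algAut {e : H} (he : ‖e‖ = 1)
    {Φ : C₀(X, H →L[ℂ] H) →ₗ[ℂ] C₀(X, H →L[ℂ] H)} (hΦ : Φ ∈ algAut C₀(X, H →L[ℂ] H)) :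
    ∃ t ∈ algAut C₀(X, ℂ), ∀ f, Φ (tens X (1 : H →L[ℂ] H) f) = tens X (1 : H →L[ℂ] H) (t f) := by
  have hcomm : ∀ (f : C₀(X, ℂ)) (G : C₀(X, H →L[ℂ] H)),
      tens X (1 : H →L[ℂ] H) f * G = G * tens X (1 : H →L[ℂ] H) f := fun f G => by
    ext x : 1
    simp
  let t : C₀(X, ℂ) →ₗ[ℂ] C₀(X, ℂ) :=
    (coeff X e : C₀(X, H →L[ℂ] H) →ₗ[ℂ] C₀(X, ℂ)) ∘ₗ Φ ∘ₗ
      (tens X (1 : H →L[ℂ] H) : C₀(X, ℂ) →ₗ[ℂ] C₀(X, H →L[ℂ] H))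
  have ht' : ∀ f, t f = coeff X e (Φ (tens X (1 : H →L[ℂ] H) f)) := fun _ => rfl
  have ht : ∀ f, Φ (tens X (1 : H →L[ℂ] H) f) = tens X (1 : H →L[ℂ] H) (t f) := by
    intro f
    refine eq_tens_one_of_commute he fun G => ?_
    obtain ⟨F, rfl⟩ := hΦ.1.2 G
    rw [← hΦ.2, ← hΦ.2, hcomm]
  have hinj : Function.Injective (tens X (1 : H →L[ℂ] H)) :=
    Function.LeftInverse.injective (coeff_tens_one he)
  refine ⟨t, ⟨⟨fun f g hfg => ?_, fun g => ?_⟩, fun f g => ?_⟩, ht⟩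
  · refine hinj (hΦ.1.1 ?_)
    rw [ht, ht, hfg]
  · obtain ⟨F, hF⟩ := hΦ.1.2 (tens X (1 : H →L[ℂ] H) g)
    have hFc : F = tens X (1 : H →L[ℂ] H) (coeff X e F) :=
      eq_tens_one_of_commute he fun G => hΦ.1.1 (by rw [hΦ.2, hΦ.2, hF, hcomm])
    refine ⟨coeff X e F, ?_⟩
    rw [ht', ← hFc, hF, coeff_tens_one he]
  · refine hinj ?_
    rw [← ht, ← mul_one (1 : H →L[ℂ] H), ← tens_mul, hΦ.2, ht, ht, tens_mul]

end

/-- Division of an operator function by the square root of its norm. -/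
theorem exists_sqrt_factor (F : C₀(X, H →L[ℂ] H)) :
    ∃ (g : C₀(X, ℂ)) (G : C₀(X, H →L[ℂ] H)), F = tens X (1 : H →L[ℂ] H) g * G ∧
      ∀ x, F x = 0 → g x = 0 := by
  have hsqrt : Continuous fun A : H →L[ℂ] H => ((√‖A‖ : ℝ) : ℂ) := by fun_prop
  have hcont : ∀ A : H →L[ℂ] H, ContinuousAt
      (fun A : H →L[ℂ] H => ((√‖A‖ : ℝ) : ℂ)⁻¹ • A) A := by
    intro A
    by_cases hA : A = 0
    · subst hA
      unfold ContinuousAt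
      beta_reduce
      rw [smul_zero, tendsto_zero_iff_norm_tendsto_zero]
      have h1 : ∀ A : H →L[ℂ] H, ‖((√‖A‖ : ℝ) : ℂ)⁻¹ • A‖ = √‖A‖ := by
        intro A
        rw [norm_smul, norm_inv, Complex.norm_real, Real.norm_of_nonneg (Real.sqrt_nonneg _)]
        by_cases h : √‖A‖ = 0
        · simp [h]
        · rw [inv_mul_eq_iff_eq_mul₀ h, Real.mul_self_sqrt (norm_nonneg _)]
      simp only [h1]
      have : Continuous fun A : H →L[ℂ] H => √‖A‖ := by fun_prop
      simpa using this.tendsto 0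
    · refine ContinuousAt.smul (ContinuousAt.inv₀ hsqrt.continuousAt ?_) continuousAt_id
      rw [Ne, Complex.ofReal_eq_zero, Real.sqrt_eq_zero (norm_nonneg _)]
      simpa using hA
  refine ⟨F.postcomp _ (fun _ => hsqrt.continuousAt) hsqrt.continuousAt (by simp),
    F.postcomp _ (fun _ => hcont _) (hcont 0) (smul_zero _), ?_, fun x hx => by simp [hx]⟩
  ext x : 1
  by_cases hx : F x = 0
  · simp [hx]
  · have : ((√‖F x‖ : ℝ) : ℂ) ≠ 0 := by
      rw [Ne, Complex.ofReal_eq_zero, Real.sqrt_eq_zero (norm_nonneg _)]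
      simpa using hx
    rw [mul_apply, tens_apply, postcomp_apply, postcomp_apply, smul_one_mul, smul_inv_smul₀ this]

/-- The square root factor is central and vanishes at `y`, and `t` carries this zero to `x`. -/
theorem algAut_apply_eq_zero {Φ : C₀(X, H →L[ℂ] H) →ₗ[ℂ] C₀(X, H →L[ℂ] H)}
    (hΦ : Φ ∈ algAut C₀(X, H →L[ℂ] H)) {t : C₀(X, ℂ) →ₗ[ℂ] C₀(X, ℂ)}
    (ht : ∀ f, Φ (tens X (1 : H →L[ℂ] H) f) = tens X (1 : H →L[ℂ] H) (t f)) {x y : X}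
    (hxy : ∀ f, t f x = f y) {F : C₀(X, H →L[ℂ] H)} (hF : F y = 0) : Φ F x = 0 := by
  obtain ⟨g, G, hFG, hg⟩ := exists_sqrt_factor F
  rw [hFG, hΦ.2, ht, mul_apply, tens_apply, hxy, hg y hF, zero_smul, zero_mul]

section

variable [LocallyCompactSpace X] [T2Space X]

/-- An automorphism of `C₀(X, B(H))` acts fibrewise by automorphisms of `B(H)`. -/
theorem exists_fibre_algAut {e : H} (he : ‖e‖ = 1)
    {Φ : C₀(X, H →L[ℂ] H) →ₗ[ℂ] C₀(X, H →L[ℂ] H)} (hΦ : Φ ∈ algAut C₀(X, H →L[ℂ] H)) (x : X) :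
    ∃ (y : X), ∃ τ ∈ algAut (H →L[ℂ] H), ∀ F, Φ F x = τ (F y) := by
  obtain ⟨t, htA, ht⟩ := exists_central_algAut he hΦ
  obtain ⟨φ, hφ⟩ := exists_equiv_of_algAut htA
  let E := LinearEquiv.ofBijective Φ hΦ.1
  have hE : (E.symm : C₀(X, H →L[ℂ] H) →ₗ[ℂ] C₀(X, H →L[ℂ] H)) ∈ algAut C₀(X, H →L[ℂ] H) := by
    refine ⟨E.symm.bijective, fun a b => hΦ.1.1 ?_⟩
    change E (E.symm (a * b)) = Φ (E.symm a * E.symm b)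
    rw [hΦ.2]
    change E (E.symm (a * b)) = E (E.symm a) * E (E.symm b)
    rw [E.apply_symm_apply, E.apply_symm_apply, E.apply_symm_apply]
  -- The inverse automorphism lies over the inverse map; this yields injectivity on the fibre.
  have hback : ∀ F, Φ F x = 0 → F (φ x) = 0 := by
    intro F hF
    let s := LinearEquiv.ofBijective t htA.1
    have := algAut_apply_eq_zero hE (t := (s.symm : C₀(X, ℂ) →ₗ[ℂ] C₀(X, ℂ))) (x := φ x) (y := x)
      (fun f => hΦ.1.1 ?_) (fun f => ?_) hF
    · rwa [show (E.symm : C₀(X, H →L[ℂ] H) →ₗ[ℂ] C₀(X, H →L[ℂ] H)) (Φ F) = F from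
        E.symm_apply_apply F] at this
    · rw [ht]
      change E (E.symm _) = tens X 1 (s (s.symm f))
      simp
    · rw [← hφ]
      change s (s.symm f) x = f x
      simp
  obtain ⟨f, hf⟩ := exists_apply_eq_one (φ x)
  let τ : (H →L[ℂ] H) →ₗ[ℂ] (H →L[ℂ] H) :=
    { toFun := fun A => Φ (tens X A f) x
      map_add' := fun A B => by
        have : tens X (A + B) f = tens X A f + tens X B f := by ext z : 1; simp
        rw [this, map_add, add_apply]
      map_smul' := fun c A => by
        have : tens X (c • A) f = c • tens X A f := by ext z : 1; exact smul_comm (f z) c A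
        rw [this, map_smul, smul_apply, RingHom.id_apply] }
  have hτ : ∀ F, Φ F x = τ (F (φ x)) := by
    intro F
    rw [← sub_eq_zero]
    change Φ F x - Φ (tens X (F (φ x)) f) x = 0
    rw [← sub_apply, ← map_sub]
    exact algAut_apply_eq_zero hΦ ht (fun f => hφ f x) (by simp [hf])
  refine ⟨φ x, τ, ⟨⟨(injective_iff_map_eq_zero _).2 fun A hA => ?_, fun A => ?_⟩, fun A B => ?_⟩, hτ⟩
  · have := hback _ hA
    simpa [hf] using this
  · obtain ⟨g, hg⟩ := exists_apply_eq_one x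
    obtain ⟨F, hF⟩ := hΦ.1.2 (tens X A g)
    exact ⟨F (φ x), by rw [← hτ, hF]; simp [hg]⟩
  · have h1 : τ (A * B) = Φ (tens X A f * tens X B f) x := by
      rw [hτ]
      simp [hf]
    rw [h1, hΦ.2]
    rfl

variable [CompleteSpace H]

/-- The spectrum lies in the disc of center 2‖A‖ and radius ‖A‖. -/
theorem re_of_mem_spectrum_add {A : H →L[ℂ] H} {z : ℂ}
    (hz : z ∈ spectrum ℂ (A + (2 * ‖A‖ : ℂ) • 1)) : ‖A‖ ≤ z.re := by
  have h1 : z - 2 * ‖A‖ ∈ spectrum ℂ A := by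
    rw [spectrum.mem_iff] at hz ⊢
    rw [Algebra.algebraMap_eq_smul_one] at hz ⊢
    convert hz using 2
    rw [sub_smul]
    abel
  have h2 : ‖z - 2 * ‖A‖‖ ≤ ‖A‖ * ‖(1 : H →L[ℂ] H)‖ := spectrum.norm_le_norm_mul_of_mem h1
  have h3 : ‖(1 : H →L[ℂ] H)‖ ≤ 1 := ContinuousLinearMap.norm_id_le
  have h4 := Complex.abs_re_le_norm (z - 2 * ‖A‖)
  have h5 : (z - 2 * ‖A‖).re = z.re - 2 * ‖A‖ := by simp
  rw [h5] at h4
  have h6 := (abs_le.1 h4).1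
  nlinarith [norm_nonneg A]

/-- A local automorphism acting on the center by composition with `φ` is local over `φ`. -/
theorem local_apply_eq_zero {e : H} (he : ‖e‖ = 1)
    {T : C₀(X, H →L[ℂ] H) →L[ℂ] C₀(X, H →L[ℂ] H)} (hT : T ∈ refAl (algAut C₀(X, H →L[ℂ] H)))
    {x y : X} (hxy : ∀ f, T (tens X (1 : H →L[ℂ] H) f) x = f y • 1)
    {F : C₀(X, H →L[ℂ] H)} (hF : F y = 0) : T F x = 0 := by
  have key : ∀ F : C₀(X, H →L[ℂ] H), F y = 0 → ∃ (A : H →L[ℂ] H), ∃ τ ∈ algAut (H →L[ℂ] H),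
      T F x = τ (A + (2 * ‖A‖ : ℂ) • 1) := by
    intro F hF
    obtain ⟨Φ, hΦ, h⟩ := hT (F + tens X (1 : H →L[ℂ] H) ((2 : ℂ) • F.normC))
    obtain ⟨z, τ, hτ, h'⟩ := exists_fibre_algAut he hΦ x
    refine ⟨F z, τ, hτ, ?_⟩
    have h2 := DFunLike.congr_fun h x
    rw [map_add, add_apply, hxy, h', add_apply, tens_apply, smul_apply, smul_apply, normC_apply,
      normC_apply, hF, norm_zero, Complex.ofReal_zero, smul_zero, zero_smul, add_zero] at h2
    exact h2
  obtain ⟨A, τ, hτ, hA⟩ := key F hF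
  obtain ⟨B, τ', hτ', hB⟩ := key (-F) (by simp [hF])
  rw [map_neg, neg_apply] at hB
  have : Nontrivial H := ⟨e, 0, by rintro rfl; simp at he⟩
  obtain ⟨z, hz⟩ := spectrum.nonempty (T F x)
  have h1 : ‖A‖ ≤ z.re := re_of_mem_spectrum_add ((algAut_mem_spectrum hτ).1 (hA ▸ hz))
  have h2 : ‖B‖ ≤ (-z).re := by
    refine re_of_mem_spectrum_add ((algAut_mem_spectrum hτ').1 (hB ▸ ?_))
    rw [← spectrum.neg_eq]
    simpa using hz
  rw [Complex.neg_re] at h2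
  have h3 : A = 0 := norm_le_zero_iff.1 (by linarith [norm_nonneg B])
  rw [hA, h3]
  simp

/-- The fibre maps of a local automorphism of `C₀(X, B(H))`. -/
theorem exists_fibre_of_local {e : H} (he : ‖e‖ = 1)
    {T : C₀(X, H →L[ℂ] H) →L[ℂ] C₀(X, H →L[ℂ] H)} (hT : T ∈ refAl (algAut C₀(X, H →L[ℂ] H)))
    {x y : X} (hxy : ∀ f, T (tens X (1 : H →L[ℂ] H) f) x = f y • 1) :
    ∃ σ : (H →L[ℂ] H) →L[ℂ] (H →L[ℂ] H), IsScaledLocalAut σ ∧ ‖σ‖ ≤ ‖T‖ ∧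
      ∀ F, T F x = σ (F y) := by
  obtain ⟨f, hf1, hf⟩ := exists_eventually_one y
  have hfy : f y = 1 := hf1.self_of_nhds
  let σ : (H →L[ℂ] H) →L[ℂ] (H →L[ℂ] H) := LinearMap.mkContinuous
    { toFun := fun A => T (tens X A f) x
      map_add' := fun A B => by
        have : tens X (A + B) f = tens X A f + tens X B f := by ext z : 1; simp
        rw [this, map_add, add_apply]
      map_smul' := fun c A => by
        have : tens X (c • A) f = c • tens X A f := by ext z : 1; exact smul_comm (f z) c A
        rw [this, map_smul, smul_apply, RingHom.id_apply] } ‖T‖ fun A => by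
    refine (norm_apply_le _ x).trans ((T.le_opNorm _).trans ?_)
    gcongr
    refine norm_le_of_forall (norm_nonneg _) fun z => ?_
    rw [tens_apply, norm_smul]
    exact mul_le_of_le_one_left (norm_nonneg _) (hf z)
  have hσ' : ∀ A, σ A = T (tens X A f) x := fun _ => rfl
  have hσ1 : σ 1 = 1 := by rw [hσ', hxy, hfy, one_smul]
  have hloc : ∀ A, ∃ c : ℂ, ∃ τ ∈ algAut (H →L[ℂ] H), σ A = c • τ A := by
    intro A
    obtain ⟨Φ, hΦ, h⟩ := hT (tens X A f)
    obtain ⟨z, τ, hτ, h'⟩ := exists_fibre_algAut he hΦ x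
    exact ⟨f z, τ, hτ, by rw [hσ', h, h', tens_apply, map_smul]⟩
  -- If `σ A = 0`, then `σ (A + 1) = 1` forces `A` to be scalar, and `σ` fixes scalars.
  have hinj : ∀ A, σ A = 0 → A = 0 := by
    intro A hA
    obtain ⟨c, τ, hτ, h⟩ := hloc (A + 1)
    have h1 : 1 = c • (A + 1) :=
      hτ.1.1 (by rw [algAut_map_one hτ, map_smul, ← h, map_add, hA, hσ1, zero_add])
    have hc : c ≠ 0 := by
      rintro rfl
      rw [zero_smul] at h1
      have := DFunLike.congr_fun h1 e
      have h0 : e = 0 := this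
      rw [h0, norm_zero] at he
      exact zero_ne_one he
    have h2 : A = (c⁻¹ - 1) • 1 := by
      rw [sub_smul, eq_sub_iff_add_eq, one_smul, eq_inv_smul_iff₀ hc, ← h1]
    rw [h2, map_smul, hσ1, ← h2] at hA
    exact hA
  refine ⟨σ, ⟨hσ1, fun A => ?_⟩, LinearMap.mkContinuous_norm_le _ (norm_nonneg T) _, fun F => ?_⟩
  · by_cases hA : A = 0
    · exact ⟨1, one_ne_zero, LinearMap.id, ⟨Function.bijective_id, fun _ _ => rfl⟩,
        by rw [hA, map_zero, map_zero, smul_zero]⟩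
    · obtain ⟨c, τ, hτ, h⟩ := hloc A
      refine ⟨c, ?_, τ, hτ, h⟩
      rintro rfl
      exact hA (hinj A (by rw [h, zero_smul]))
  · rw [hσ', ← sub_eq_zero, ← sub_apply, ← map_sub]
    exact local_apply_eq_zero he hT hxy (by simp [hfy])

/-- A local automorphism acting on the center by an automorphism is an automorphism. -/
theorem mem_algAut_of_local (b : HilbertBasis ℕ ℂ H)
    {T : C₀(X, H →L[ℂ] H) →L[ℂ] C₀(X, H →L[ℂ] H)} (hT : T ∈ refAl (algAut C₀(X, H →L[ℂ] H)))
    {t : C₀(X, ℂ) →ₗ[ℂ] C₀(X, ℂ)} (htA : t ∈ algAut C₀(X, ℂ))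
    (ht : ∀ f, T (tens X (1 : H →L[ℂ] H) f) = tens X (1 : H →L[ℂ] H) (t f)) :
    (T : C₀(X, H →L[ℂ] H) →ₗ[ℂ] C₀(X, H →L[ℂ] H)) ∈ algAut C₀(X, H →L[ℂ] H) := by
  obtain ⟨φ, hφ⟩ := exists_equiv_of_algAut htA
  have hfib := fun x => exists_fibre_of_local (b.orthonormal.1 0) hT (x := x) (y := φ x)
    fun f => by rw [ht, tens_apply, hφ]
  choose σ hσ hσn hTσ using hfib
  have hbound : ∀ x A, ‖A‖ ≤ ‖T‖ * ‖σ x A‖ := fun x A =>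
    ((hσ x).norm_le b A).trans (by gcongr; exact hσn x)
  -- Surjectivity of `t` replaces continuity and properness of `φ.symm`.
  have hcomp : ∀ f : C₀(X, ℂ), ∃ g : C₀(X, ℂ), ∀ z, g z = f (φ.symm z) := by
    intro f
    obtain ⟨g, rfl⟩ := htA.1.2 f
    exact ⟨g, fun z => by rw [hφ, φ.apply_symm_apply]⟩
  refine ⟨⟨(injective_iff_map_eq_zero _).2 fun F hF => ?_, fun G => ?_⟩, fun F G => ?_⟩
  · ext z : 1
    refine (hσ (φ.symm z)).eq_zero ?_
    have := hTσ (φ.symm z) F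
    rw [φ.apply_symm_apply] at this
    rw [← this]
    exact DFunLike.congr_fun hF _
  · have hsurj : ∀ z, ∃ A, σ (φ.symm z) A = G (φ.symm z) := fun z =>
      ((hσ _).mem_algAut b).1.2 _
    choose F hF using hsurj
    have hFcont : Continuous F := by
      rw [continuous_iff_continuousAt]
      intro z₀
      obtain ⟨f, hf, -⟩ := exists_eventually_one z₀
      obtain ⟨g, hg⟩ := hcomp (G - T (tens X (F z₀) f)).normC
      -- Near `z₀` the constant `F z₀` is the fibre value of `tens X (F z₀) f`, so the uniform lower
      -- bound controls `F z - F z₀` by a continuous function vanishing at `z₀`.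
      have hle : ∀ᶠ z in nhds z₀, ‖F z - F z₀‖ ≤ ‖T‖ * ‖g z‖ := by
        filter_upwards [hf] with z hz
        refine (hbound (φ.symm z) _).trans_eq ?_
        rw [hg, normC_apply, sub_apply, hTσ, map_sub, hF, φ.apply_symm_apply, tens_apply, hz,
          one_smul]
        simp
      have hg0 : g z₀ = 0 := by
        rw [hg, normC_apply, sub_apply, hTσ, φ.apply_symm_apply, tens_apply, hf.self_of_nhds,
          one_smul, hF]
        simp
      have hlim : Filter.Tendsto (fun z => ‖T‖ * ‖g z‖) (nhds z₀) (nhds 0) := by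
        have := ((map_continuous g).norm.const_mul ‖T‖).tendsto z₀
        simpa [hg0] using this
      unfold ContinuousAt
      rw [tendsto_iff_norm_sub_tendsto_zero]
      exact squeeze_zero' (Filter.Eventually.of_forall fun _ => norm_nonneg _) hle hlim
    have hFzero : Filter.Tendsto F (Filter.cocompact X) (nhds 0) := by
      obtain ⟨g, hg⟩ := hcomp G.normC
      have hlim : Filter.Tendsto (fun z => ‖T‖ * ‖g z‖) (Filter.cocompact X) (nhds 0) := by
        have := (zero_at_infty g).norm.const_mul ‖T‖
        simpa using this
      rw [tendsto_zero_iff_norm_tendsto_zero]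
      refine squeeze_zero (fun _ => norm_nonneg _) (fun z => ?_) hlim
      refine (hbound (φ.symm z) _).trans_eq ?_
      rw [hg, normC_apply, hF]
      simp
    refine ⟨⟨⟨F, hFcont⟩, hFzero⟩, ?_⟩
    ext x : 1
    change T _ x = _
    rw [hTσ]
    change σ x (F (φ x)) = G x
    have := hF (φ x)
    rwa [φ.symm_apply_apply] at this
  · ext x : 1
    change T (F * G) x = (T F * T G) x
    rw [mul_apply, hTσ, hTσ, hTσ, mul_apply]
    exact ((hσ x).mem_algAut b).2 _ _

end

end ZeroAtInftyContinuousMap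

/-! ### Reduction to the center -/

open ZeroAtInftyContinuousMap

theorem theorem2 (X : Type*) [TopologicalSpace X] [LocallyCompactSpace X] [T2Space X]
    (H : Type*) [NormedAddCommGroup H] [InnerProductSpace ℂ H] [CompleteSpace H]
    [TopologicalSpace.SeparableSpace H] (hH : ¬ FiniteDimensional ℂ H)
    (hX : IsAlgReflexive (algAut C₀(X, ℂ))) :
    IsAlgReflexive (algAut C₀(X, H →L[ℂ] H)) := by
  obtain ⟨b⟩ := exists_hilbertBasis_nat hH
  refine Set.Subset.antisymm (fun T hT => ?_) fun T hT F => ⟨_, hT, rfl⟩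
  have he := b.orthonormal.1 0
  let t : C₀(X, ℂ) →L[ℂ] C₀(X, ℂ) := (coeff X (b 0)).comp (T.comp (tens X (1 : H →L[ℂ] H)))
  have key : ∀ f, ∃ s ∈ algAut C₀(X, ℂ), t f = s f ∧
      T (tens X (1 : H →L[ℂ] H) f) = tens X (1 : H →L[ℂ] H) (t f) := by
    intro f
    obtain ⟨Φ, hΦ, h⟩ := hT (tens X (1 : H →L[ℂ] H) f)
    obtain ⟨s, hs, h'⟩ := exists_central_algAut he hΦ
    have hts : t f = s f := by
      change coeff X (b 0) (T (tens X (1 : H →L[ℂ] H) f)) = s f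
      rw [h, h', coeff_tens_one he]
    exact ⟨s, hs, hts, by rw [h, h', hts]⟩
  have ht : t ∈ refAl (algAut C₀(X, ℂ)) := fun f => by
    obtain ⟨s, hs, h, -⟩ := key f
    exact ⟨s, hs, h⟩
  rw [hX] at ht
  exact mem_algAut_of_local b hT ht fun f => by
    obtain ⟨s, -, -, h⟩ := key f
    exact h
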